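/- Let $X$ and $Y$ be Banach spaces over the same scalar field $\mathbb{R}$ or $\mathbb{C}$, let $\mathcal{L}(X,Y)$ be the space of bounded linear operators from $X$ to $Y$ with the operator norm, and let $\mathcal{K}(X,Y)$ be its subspace of compact operators. A unit vector $z$ of a Banach space $Z$ is a smooth point of $Z$ if there is exactly one $f\in Z^{*}$ with $\|f\|=1=f(z)$; it is a very smooth point of $Z$ if, moreover, its canonical image in $Z^{**}$ is a smooth point of $Z^{**}$. A closed subspace $M$ of $Z$ is an $M$-ideal in $Z$ if there is a bounded linear projection $P$ on $Z^{*}$ with $\ker P=\{f\in Z^{*}: f(m)=0 \text{ for all } m\in M\}$ and $\|f\|=\|P(f)\|+\|f-P(f)\|$ for all $f\in Z^{*}$. Suppose that $\mathcal{K}(X,Y)$ is an $M$-ideal in $\mathcal{L}(X,Y)$, and let $T$ be a very smooth point of $\mathcal{L}(X,Y)$. Then there is a unit vector $x\in X$ with $\|T(x)\|=\|T\|$; it is unique up to a scalar multiple, that is, every unit vector $x'\in X$ with $\|T(x')\|=\|T\|$ is of the form $x'=cx$ for a scalar $c$ with $|c|=1$. Moreover, $T(x)$ is a very smooth point of $Y$.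 -/

import Mathlib

open NormedSpace

/-- A smooth point of a normed space: a unit vector `x` with a unique norming functional,
that is, a unique functional `f` in the dual with `‖f‖ = 1` and `f x = 1`. -/
def IsSmoothPoint (𝕜 : Type*) [RCLike 𝕜] {E : Type*} [NormedAddCommGroup E] [NormedSpace 𝕜 E]
    (x : E) : Prop :=
  ‖x‖ = 1 ∧ ∃! f : StrongDual 𝕜 E, ‖f‖ = 1 ∧ f x = 1

/-- A very smooth point of a normed space: a smooth point whose canonical image in the bidual
is a smooth point of the bidual. -/
def IsVerySmoothPoint (𝕜 : Type*) [RCLike 𝕜] {E : Type*} [NormedAddCommGroup E]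
    [NormedSpace 𝕜 E] (x : E) : Prop :=
  IsSmoothPoint 𝕜 x ∧ IsSmoothPoint 𝕜 (inclusionInDoubleDual 𝕜 E x)

/-- An `M`-ideal of a normed space `E`: a closed subspace `M` whose annihilator is the kernel of
an `L`-projection `P` on the dual of `E`, that is, of a bounded projection with
`‖f‖ = ‖P f‖ + ‖f - P f‖` for all `f`. -/
def IsMIdeal {𝕜 : Type*} [RCLike 𝕜] {E : Type*} [NormedAddCommGroup E] [NormedSpace 𝕜 E]
    (M : Submodule 𝕜 E) : Prop :=
  IsClosed (M : Set E) ∧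
    ∃ P : StrongDual 𝕜 E →L[𝕜] StrongDual 𝕜 E,
      IsLprojection (StrongDual 𝕜 E) P ∧
        ∀ f : StrongDual 𝕜 E, P f = 0 ↔ ∀ m ∈ M, f m = 0

/-! The functional `F` norming `T` is a dyad `S ↦ g (S x)` with unit `x` and `g`. Dyads that
asymptotically norm `T` have a limit in the third dual of the operator space that norms the image of
`T` in the bidual; smoothness there identifies it with `F`, so the dyads converge weakly to `F`. The
`L`-projection `P` fixes dyads, hence also `F`, so `F` is determined by its values on compact
operators. There the limit is computed from the weak-star limits of the two factors, and the limit
of the first lies in `X` because `X` is weakly closed in its bidual.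

Any unit vector where `T` attains its norm yields a dyad norming `T`, which must be `F`; this gives
uniqueness. Evaluation at `x` has norm at most one and a bounded right inverse, so it carries very
smoothness from `T` to `T x`. -/

/-! ### Weak and weak-star limits along ultrafilters -/

open Filter Topology in
/-- Along an ultrafilter, a sequence in the unit ball of a dual space converges weak-star. -/
theorem exists_weakStar_limit_ultrafilter {𝕜 : Type*} [RCLike 𝕜] {E : Type*}
    [NormedAddCommGroup E] [NormedSpace 𝕜 E] {ι : Type*} (U : Ultrafilter ι)
    (f : ι → StrongDual 𝕜 E) (hf : ∀ i, ‖f i‖ ≤ 1) :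
    ∃ g : StrongDual 𝕜 E, ‖g‖ ≤ 1 ∧ ∀ x, Tendsto (fun i => f i x) U (𝓝 (g x)) := by
  have hc := WeakDual.isCompact_closedBall (𝕜 := 𝕜) (E := E) 0 1
  rw [isCompact_iff_ultrafilter_le_nhds] at hc
  obtain ⟨g, hg, hlim⟩ := hc (U.map fun i => StrongDual.toWeakDual (f i)) (by
    rw [le_principal_iff]
    exact Filter.mem_map.2 (Filter.univ_mem' fun i => by simpa using hf i))
  refine ⟨WeakDual.toStrongDual g, by simpa using hg, fun x => ?_⟩
  exact ((WeakDual.eval_continuous x).tendsto g).comp hlim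

/-- A point annihilated by every functional that vanishes on a closed subspace belongs to it. -/
theorem Submodule.mem_of_forall_strongDual_eq_zero {𝕜 : Type*} [RCLike 𝕜] {E : Type*}
    [NormedAddCommGroup E] [NormedSpace 𝕜 E] (N : Submodule 𝕜 E) (hN : IsClosed (N : Set E))
    (x : E) (h : ∀ ψ : StrongDual 𝕜 E, (∀ n ∈ N, ψ n = 0) → ψ x = 0) : x ∈ N := by
  have := hN
  rw [← Submodule.Quotient.mk_eq_zero]
  refine SeparatingDual.eq_zero_of_forall_dual_eq_zero (R := 𝕜) fun g => ?_
  refine h (g.comp N.mkQL) fun n hn => ?_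
  have : N.mkQL n = 0 := (Submodule.Quotient.mk_eq_zero N).2 hn
  simp [this]

open Filter Topology in
/-- The range of a linear isometric map from a complete space is weakly closed: if a weakly
convergent net is mapped into it by a bounded operator, then so is the limit. -/
theorem ContinuousLinearMap.mem_range_of_tendsto_weakly {𝕜 : Type*} [RCLike 𝕜]
    {D E F : Type*} [NormedAddCommGroup D] [NormedSpace 𝕜 D] [NormedAddCommGroup E]
    [NormedSpace 𝕜 E] [CompleteSpace E] [NormedAddCommGroup F] [NormedSpace 𝕜 F]
    (J : E →L[𝕜] F) (hJ : ∀ a, ‖J a‖ = ‖a‖) (A : D →L[𝕜] F) {ι : Type*} (U : Ultrafilter ι)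
    {u : ι → D} {v : D} (huv : ∀ ψ : StrongDual 𝕜 D, Tendsto (fun i => ψ (u i)) U (𝓝 (ψ v)))
    (hu : ∀ i, ∃ a, J a = A (u i)) : ∃ a, J a = A v := by
  have hiso : Isometry J := AddMonoidHomClass.isometry_of_norm J hJ
  refine Submodule.mem_of_forall_strongDual_eq_zero J.toLinearMap.range
    hiso.isUniformInducing.isComplete_range.isClosed (A v) fun ψ hψ => ?_
  have hlim := huv (ψ.comp A)
  have hzero : ∀ i, ψ.comp A (u i) = 0 := fun i => hψ _ (hu i)
  simp only [hzero] at hlim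
  exact tendsto_nhds_unique hlim tendsto_const_nhds

/-- A functional bounded by one that takes the value one at a unit vector has norm one. -/
theorem StrongDual.norm_eq_one_of_apply_eq_one {𝕜 : Type*} [RCLike 𝕜] {E : Type*}
    [NormedAddCommGroup E] [NormedSpace 𝕜 E] {f : StrongDual 𝕜 E} {x : E} (hf : ‖f‖ ≤ 1)
    (hx : ‖x‖ ≤ 1) (h : f x = 1) : ‖f‖ = 1 := by
  refine le_antisymm hf ?_
  have := f.le_opNorm x
  rw [h, norm_one] at this
  nlinarith [norm_nonneg f]

open Filter Topology in
/-- If a unit vector `f` norms a smooth point `w` of the dual, then every net in the unit ball that is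
asymptotically norming for `w` converges weakly to `f`. -/
theorem IsSmoothPoint.tendsto_weakly {𝕜 : Type*} [RCLike 𝕜] {D : Type*}
    [NormedAddCommGroup D] [NormedSpace 𝕜 D] {w : StrongDual 𝕜 D} (hw : IsSmoothPoint 𝕜 w)
    {f : D} (hf : ‖f‖ ≤ 1) (hwf : w f = 1) {ι : Type*} (U : Ultrafilter ι)
    (F : ι → D) (hF : ∀ i, ‖F i‖ ≤ 1) (hwF : Tendsto (fun i => w (F i)) U (𝓝 1))
    (ψ : StrongDual 𝕜 D) : Tendsto (fun i => ψ (F i)) U (𝓝 (ψ f)) := by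
  obtain ⟨Φ, hΦ, hlim⟩ := exists_weakStar_limit_ultrafilter U
    (fun i => inclusionInDoubleDual 𝕜 D (F i)) (fun i => (double_dual_bound 𝕜 D _).trans (hF i))
  have hΦw : Φ w = 1 := tendsto_nhds_unique (hlim w) hwF
  have hfw : inclusionInDoubleDual 𝕜 D f w = 1 := hwf
  have hΦf : Φ = inclusionInDoubleDual 𝕜 D f :=
    hw.2.unique ⟨StrongDual.norm_eq_one_of_apply_eq_one hΦ hw.1.le hΦw, hΦw⟩
      ⟨StrongDual.norm_eq_one_of_apply_eq_one ((double_dual_bound 𝕜 D f).trans hf) hw.1.le hfw, hfw⟩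
  have := hlim ψ
  rw [hΦf] at this
  exact this

/-! ### Images of smooth and very smooth points -/

/-- A surjective map of norm at most one that preserves the norm of a smooth point maps it to a
smooth point. -/
theorem IsSmoothPoint.map_of_surjective {𝕜 : Type*} [RCLike 𝕜] {E F : Type*}
    [NormedAddCommGroup E] [NormedSpace 𝕜 E] [NormedAddCommGroup F] [NormedSpace 𝕜 F] {z : E}
    (hz : IsSmoothPoint 𝕜 z) (e : E →L[𝕜] F) (he : ‖e‖ ≤ 1) (hsurj : Function.Surjective e)
    (hez : ‖e z‖ = 1) : IsSmoothPoint 𝕜 (e z) := by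
  have hpull : ∀ g : StrongDual 𝕜 F, ‖g‖ = 1 ∧ g (e z) = 1 →
      ‖g.comp e‖ = 1 ∧ g.comp e z = 1 := fun g hg => by
    have h1 : g.comp e z = 1 := hg.2
    refine ⟨StrongDual.norm_eq_one_of_apply_eq_one ?_ hz.1.le h1, h1⟩
    refine (g.opNorm_comp_le e).trans ?_
    rwa [hg.1, one_mul]
  obtain ⟨g, hg, hgz⟩ := exists_dual_vector 𝕜 (e z) (by simp [hez])
  have hg1 : ‖g‖ = 1 ∧ g (e z) = 1 := ⟨hg, by simp [hgz, hez]⟩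
  refine ⟨hez, g, hg1, fun h hh => ?_⟩
  have heq := hz.2.unique (hpull h hh) (hpull g hg1)
  refine ContinuousLinearMap.ext fun y => ?_
  obtain ⟨v, rfl⟩ := hsurj y
  exact congrArg (fun G => G v) heq

/-- The adjoint of a bounded operator between normed spaces. -/
noncomputable def strongDualAdjoint {𝕜 : Type*} [RCLike 𝕜] {E F : Type*}
    [NormedAddCommGroup E] [NormedSpace 𝕜 E] [NormedAddCommGroup F] [NormedSpace 𝕜 F]
    (e : E →L[𝕜] F) : StrongDual 𝕜 F →L[𝕜] StrongDual 𝕜 E :=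
  (ContinuousLinearMap.compL 𝕜 E F 𝕜).flip e

@[simp]
theorem strongDualAdjoint_apply {𝕜 : Type*} [RCLike 𝕜] {E F : Type*}
    [NormedAddCommGroup E] [NormedSpace 𝕜 E] [NormedAddCommGroup F] [NormedSpace 𝕜 F]
    (e : E →L[𝕜] F) (g : StrongDual 𝕜 F) : strongDualAdjoint e g = g.comp e := rfl

theorem norm_strongDualAdjoint_le {𝕜 : Type*} [RCLike 𝕜] {E F : Type*}
    [NormedAddCommGroup E] [NormedSpace 𝕜 E] [NormedAddCommGroup F] [NormedSpace 𝕜 F]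
    (e : E →L[𝕜] F) : ‖strongDualAdjoint e‖ ≤ ‖e‖ :=
  ContinuousLinearMap.opNorm_le_bound _ (norm_nonneg e) fun g =>
    (g.opNorm_comp_le e).trans (mul_comm _ _).le

/-- A map of norm at most one with a right inverse that preserves the norm of a very smooth point
maps it to a very smooth point. -/
theorem IsVerySmoothPoint.map_of_rightInverse {𝕜 : Type*} [RCLike 𝕜] {E F : Type*}
    [NormedAddCommGroup E] [NormedSpace 𝕜 E] [NormedAddCommGroup F] [NormedSpace 𝕜 F] {z : E}
    (hz : IsVerySmoothPoint 𝕜 z) (e : E →L[𝕜] F) (he : ‖e‖ ≤ 1) (j : F →L[𝕜] E)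
    (hj : ∀ y, e (j y) = y) (hez : ‖e z‖ = 1) : IsVerySmoothPoint 𝕜 (e z) := by
  refine ⟨hz.1.map_of_surjective e he (fun y => ⟨j y, hj y⟩) hez, ?_⟩
  refine hz.2.map_of_surjective (strongDualAdjoint (strongDualAdjoint e))
    ((norm_strongDualAdjoint_le _).trans ((norm_strongDualAdjoint_le e).trans he)) (fun η => ?_)
    (((inclusionInDoubleDualLi 𝕜 (E := F)).norm_map (e z)).trans hez)
  -- The second adjoint of `j` is a right inverse of that of `e`.
  refine ⟨η.comp (strongDualAdjoint j), ContinuousLinearMap.ext fun g => ?_⟩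
  change η ((g.comp e).comp j) = η g
  congr 1
  ext y
  simp [hj]

/-! ### Dyads and the `L`-projection -/

section Dyad

variable {𝕜 : Type*} [RCLike 𝕜] {X : Type*} [NormedAddCommGroup X] [NormedSpace 𝕜 X]
  {Y : Type*} [NormedAddCommGroup Y] [NormedSpace 𝕜 Y]

/-- The functional `S ↦ g (S x)` on the space of bounded operators. -/
noncomputable def operatorDyad (x : X) (g : StrongDual 𝕜 Y) : StrongDual 𝕜 (X →L[𝕜] Y) :=
  g.comp (ContinuousLinearMap.apply 𝕜 Y x)

@[simp]
theorem operatorDyad_apply (x : X) (g : StrongDual 𝕜 Y) (S : X →L[𝕜] Y) :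
    operatorDyad x g S = g (S x) := rfl

theorem norm_operatorDyad_le (x : X) (g : StrongDual 𝕜 Y) :
    ‖operatorDyad x g‖ ≤ ‖x‖ * ‖g‖ := by
  refine ContinuousLinearMap.opNorm_le_bound _ (by positivity) fun S => ?_
  calc ‖g (S x)‖ ≤ ‖g‖ * ‖S x‖ := g.le_opNorm _
    _ ≤ ‖g‖ * (‖S‖ * ‖x‖) := by gcongr; exact S.le_opNorm x
    _ = ‖x‖ * ‖g‖ * ‖S‖ := by ring

theorem isCompactOperator_smulRight (f : StrongDual 𝕜 X) (y : Y) :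
    IsCompactOperator (f.smulRight y) := by
  have h : IsCompactOperator ((ContinuousLinearMap.id 𝕜 𝕜).smulRight y) :=
    isCompactOperator_of_locallyCompactSpace_rng _
  exact h.comp_clm f

/-- A functional agreeing with a dyad on the compact operators has at least its norm. -/
theorem norm_mul_norm_le_of_eq_operatorDyad (x : X) (g : StrongDual 𝕜 Y)
    (G : StrongDual 𝕜 (X →L[𝕜] Y))
    (h : ∀ K ∈ compactOperator (RingHom.id 𝕜) X Y, G K = g (K x)) : ‖x‖ * ‖g‖ ≤ ‖G‖ := by
  -- Rank-one operators built from an `f` norming `x` already detect the norm of the dyad.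
  obtain ⟨f, hf, hfx⟩ := exists_dual_vector'' 𝕜 x
  suffices ‖(‖x‖ : 𝕜) • g‖ ≤ ‖G‖ by simpa [norm_smul] using this
  refine ContinuousLinearMap.opNorm_le_bound _ (norm_nonneg G) fun y => ?_
  have := h (f.smulRight y) (isCompactOperator_smulRight f y)
  simp only [ContinuousLinearMap.smulRight_apply, hfx, map_smul] at this
  rw [smul_apply, ← this]
  refine (G.le_opNorm _).trans ?_
  rw [ContinuousLinearMap.norm_smulRight_apply]
  gcongr
  exact mul_le_of_le_one_left (norm_nonneg _) hf

/-- An `L`-projection whose kernel is the annihilator of the compact operators fixes dyads. -/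
theorem IsLprojection.apply_operatorDyad
    {P : StrongDual 𝕜 (X →L[𝕜] Y) →L[𝕜] StrongDual 𝕜 (X →L[𝕜] Y)}
    (hP : IsLprojection (StrongDual 𝕜 (X →L[𝕜] Y)) P)
    (hker : ∀ f, P f = 0 ↔ ∀ m ∈ compactOperator (RingHom.id 𝕜) X Y, f m = 0)
    (x : X) (g : StrongDual 𝕜 Y) : P (operatorDyad x g) = operatorDyad x g := by
  have hPP : P (P (operatorDyad x g)) = P (operatorDyad x g) :=
    congrArg (fun Q => Q (operatorDyad x g)) hP.proj.eq
  have h0 : P (P (operatorDyad x g) - operatorDyad x g) = 0 := by rw [map_sub, hPP, sub_self]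
  -- The image under `P` agrees with the dyad on compact operators, so it is at least as long;
  -- additivity of the norm leaves nothing for the complementary part.
  have hle := norm_mul_norm_le_of_eq_operatorDyad x g (P (operatorDyad x g)) fun K hK =>
    sub_eq_zero.1 ((hker _).1 h0 K hK)
  have hL := hP.Lnorm (operatorDyad x g)
  have hle' := norm_operatorDyad_le x g
  have h1 : ‖((1 - P) • operatorDyad x g)‖ ≤ 0 := by
    change ‖operatorDyad x g‖ = ‖P (operatorDyad x g)‖ + _ at hL
    linarith
  exact (sub_eq_zero.1 (norm_le_zero_iff.1 h1)).symm

/-! ### Weak limits of dyads -/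

open Filter Topology in
/-- Compact operators turn weak-star convergence along an ultrafilter into norm convergence. -/
theorem exists_tendsto_compactOperator {ι : Type*} (U : Ultrafilter ι) (x : ι → X)
    (hx : ∀ i, ‖x i‖ ≤ 1) (K : X →L[𝕜] Y) (hK : IsCompactOperator K) :
    ∃ z : Y, Tendsto (fun i => K (x i)) U (𝓝 z) := by
  obtain ⟨C, hC, hKC⟩ := IsCompactOperator.image_closedBall_subset_compact
    (f := (K : X →ₗ[𝕜] Y)) hK 1
  rw [isCompact_iff_ultrafilter_le_nhds] at hC
  obtain ⟨z, -, hz⟩ := hC (U.map fun i => K (x i)) (by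
    rw [le_principal_iff]
    exact Filter.mem_map.2 (Filter.univ_mem' fun i => hKC ⟨x i, by simpa using hx i, rfl⟩))
  exact ⟨z, hz⟩

open Filter Topology in
/-- There are dyads in the dual ball asymptotically norming a given operator. -/
theorem exists_seq_operatorDyad_tendsto (T : X →L[𝕜] Y) (hT : ‖T‖ = 1) :
    ∃ (x : ℕ → X) (g : ℕ → StrongDual 𝕜 Y), (∀ n, ‖x n‖ ≤ 1) ∧ (∀ n, ‖g n‖ ≤ 1) ∧
      Tendsto (fun n => g n (T (x n))) atTop (𝓝 1) := by
  have h : ∀ n : ℕ, ∃ x : X, ‖x‖ < 1 ∧ 1 - 1 / ((n : ℝ) + 1) < ‖T x‖ := fun n =>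
    T.exists_lt_apply_of_lt_opNorm (by rw [hT]; have : 0 < 1 / ((n : ℝ) + 1) := by positivity
                                       linarith)
  choose x hx hTx using h
  choose g hg hgx using fun n => exists_dual_vector'' 𝕜 (T (x n))
  refine ⟨x, g, fun n => (hx n).le, hg, ?_⟩
  have hlim : Tendsto (fun n => ‖T (x n)‖) atTop (𝓝 1) := by
    refine tendsto_of_tendsto_of_tendsto_of_le_of_le (g := fun n : ℕ => 1 - 1 / ((n : ℝ) + 1))
      (h := fun _ => 1) ?_ tendsto_const_nhds (fun n => (hTx n).le) fun n => ?_
    · simpa using (tendsto_one_div_add_atTop_nhds_zero_nat (𝕜 := ℝ)).const_sub 1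
    · calc ‖T (x n)‖ ≤ ‖T‖ * ‖x n‖ := T.le_opNorm _
        _ ≤ 1 := by rw [hT, one_mul]; exact (hx n).le
  simp only [hgx]
  simpa [Function.comp_def] using ((RCLike.continuous_ofReal (K := 𝕜)).tendsto 1).comp hlim

open Filter Topology in
/-- If dyads converge weakly to a functional and their second factors have a nonzero weak-star limit,
then the weak-star limit of the first factors lies in the space itself. -/
theorem mem_range_inclusionInDoubleDual_of_tendsto_operatorDyad [CompleteSpace X] {ι : Type*}
    (U : Ultrafilter ι) {x : ι → X} {g : ι → StrongDual 𝕜 Y} {F : StrongDual 𝕜 (X →L[𝕜] Y)}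
    (hweak : ∀ ψ : StrongDual 𝕜 (StrongDual 𝕜 (X →L[𝕜] Y)),
      Tendsto (fun i => ψ (operatorDyad (x i) (g i))) U (𝓝 (ψ F)))
    {ξ : StrongDual 𝕜 (StrongDual 𝕜 X)}
    (hξ : ∀ f : StrongDual 𝕜 X, Tendsto (fun i => f (x i)) U (𝓝 (ξ f)))
    {γ : StrongDual 𝕜 Y} (hγ : ∀ y, Tendsto (fun i => g i y) U (𝓝 (γ y))) (hγ0 : γ ≠ 0) :
    ∃ a, inclusionInDoubleDual 𝕜 X a = ξ := by
  obtain ⟨y, hy⟩ : ∃ y, γ y ≠ 0 := by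
    by_contra! hcon
    exact hγ0 (ContinuousLinearMap.ext hcon)
  -- The adjoint of `R` sends each dyad to the image of `g i y • x i` in the bidual, and sends `F`
  -- to `γ y • ξ`.
  let R : StrongDual 𝕜 X →L[𝕜] (X →L[𝕜] Y) := (ContinuousLinearMap.smulRightL 𝕜 X Y).flip y
  have hR : ∀ f a, R f a = f a • y := fun f a => rfl
  have hdyad : ∀ i, inclusionInDoubleDual 𝕜 X (g i y • x i) =
      strongDualAdjoint R (operatorDyad (x i) (g i)) := fun i => by
    ext f
    simp [hR, mul_comm]
  have hFR : strongDualAdjoint R F = γ y • ξ := by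
    ext f
    refine tendsto_nhds_unique (hweak (inclusionInDoubleDual 𝕜 (X →L[𝕜] Y) (R f))) ?_
    simpa [hR, mul_comm] using (hγ y).mul (hξ f)
  obtain ⟨a, ha⟩ := ContinuousLinearMap.mem_range_of_tendsto_weakly (inclusionInDoubleDual 𝕜 X)
    (inclusionInDoubleDualLi 𝕜 (E := X)).norm_map (strongDualAdjoint R) U hweak
    fun i => ⟨_, hdyad i⟩
  exact ⟨(γ y)⁻¹ • a, by rw [map_smul, ha, hFR, inv_smul_smul₀ hy]⟩

open Filter Topology in
/-- The limit of dyads at a compact operator, in terms of the limits of their factors. -/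
theorem exists_apply_compactOperator_eq {ι : Type*} (U : Ultrafilter ι) {x : ι → X}
    (hx : ∀ i, ‖x i‖ ≤ 1) {g : ι → StrongDual 𝕜 Y} (hg : ∀ i, ‖g i‖ ≤ 1)
    {ξ : StrongDual 𝕜 (StrongDual 𝕜 X)}
    (hξ : ∀ f : StrongDual 𝕜 X, Tendsto (fun i => f (x i)) U (𝓝 (ξ f)))
    {γ : StrongDual 𝕜 Y} (hγ : ∀ y, Tendsto (fun i => g i y) U (𝓝 (γ y)))
    (K : X →L[𝕜] Y) (hK : IsCompactOperator K) {c : 𝕜}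
    (hc : Tendsto (fun i => g i (K (x i))) U (𝓝 c)) :
    ∃ z : Y, c = γ z ∧ ∀ h : StrongDual 𝕜 Y, h z = ξ (h.comp K) := by
  obtain ⟨z, hz⟩ := exists_tendsto_compactOperator U x hx K hK
  refine ⟨z, tendsto_nhds_unique hc ?_, fun h =>
    tendsto_nhds_unique ((h.continuous.tendsto z).comp hz) (hξ (h.comp K))⟩
  -- Norm convergence of `K (x i)` is what allows pairing with the merely weak-star convergent `g
  -- i`.
  have h0 : Tendsto (fun i => g i (K (x i) - z)) U (𝓝 0) := by
    refine squeeze_zero_norm (a := fun i => ‖K (x i) - z‖) (fun i => ?_) ?_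
    · exact ((g i).le_opNorm _).trans (mul_le_of_le_one_left (norm_nonneg _) (hg i))
    · simpa using (hz.sub_const z).norm
  simpa using h0.add (hγ z)

open Filter Topology in
/-- If the compact operators form an `M`-ideal, a functional of norm one that is a weak limit of
dyads from the unit balls is a dyad of unit vectors. -/
theorem IsMIdeal.exists_eq_operatorDyad [CompleteSpace X]
    (hM : IsMIdeal (compactOperator (RingHom.id 𝕜) X Y)) {ι : Type*} (U : Ultrafilter ι)
    {x : ι → X} (hx : ∀ i, ‖x i‖ ≤ 1) {g : ι → StrongDual 𝕜 Y} (hg : ∀ i, ‖g i‖ ≤ 1)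
    {F : StrongDual 𝕜 (X →L[𝕜] Y)} (hF : ‖F‖ = 1)
    (hweak : ∀ ψ : StrongDual 𝕜 (StrongDual 𝕜 (X →L[𝕜] Y)),
      Tendsto (fun i => ψ (operatorDyad (x i) (g i))) U (𝓝 (ψ F))) :
    ∃ (a : X) (γ : StrongDual 𝕜 Y), ‖a‖ = 1 ∧ ‖γ‖ = 1 ∧ F = operatorDyad a γ := by
  obtain ⟨-, P, hP, hker⟩ := hM
  have hPF : P F = F := by
    refine sub_eq_zero.1 (SeparatingDual.eq_zero_of_forall_dual_eq_zero (R := 𝕜) fun ψ => ?_)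
    rw [map_sub]
    have hlim := (hweak (ψ.comp P)).sub (hweak ψ)
    simp only [ContinuousLinearMap.comp_apply, hP.apply_operatorDyad hker, sub_self] at hlim
    exact tendsto_nhds_unique hlim tendsto_const_nhds
  obtain ⟨ξ, hξ, hxlim⟩ := exists_weakStar_limit_ultrafilter U
    (fun i => inclusionInDoubleDual 𝕜 X (x i)) (fun i => (double_dual_bound 𝕜 X _).trans (hx i))
  obtain ⟨γ, hγ, hglim⟩ := exists_weakStar_limit_ultrafilter U g hg
  have hK : ∀ K ∈ compactOperator (RingHom.id 𝕜) X Y, ∃ z : Y, F K = γ z ∧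
      ∀ h : StrongDual 𝕜 Y, h z = ξ (h.comp K) := fun K hK =>
    exists_apply_compactOperator_eq U hx hg hxlim hglim K hK
      (hweak (inclusionInDoubleDual 𝕜 (X →L[𝕜] Y) K))
  have hγ0 : γ ≠ 0 := by
    rintro rfl
    have h0 : P F = 0 := (hker F).2 fun K hKc => by
      obtain ⟨z, hz, -⟩ := hK K hKc
      exact hz
    rw [← hPF, h0] at hF
    exact zero_ne_one ((norm_zero (E := StrongDual 𝕜 (X →L[𝕜] Y))).symm.trans hF)
  obtain ⟨a, ha⟩ :=
    mem_range_inclusionInDoubleDual_of_tendsto_operatorDyad U hweak hxlim hglim hγ0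
  have hFa : F = operatorDyad a γ := by
    -- The difference vanishes on compact operators, so `P` kills it; but `P` also fixes it.
    have h0 : P (F - operatorDyad a γ) = 0 := by
      refine (hker _).2 fun K hKc => ?_
      obtain ⟨z, hz, hzξ⟩ := hK K hKc
      have : z = K a := (SeparatingDual.eq_iff_forall_dual_eq (R := 𝕜)).2 fun h => by
        rw [hzξ, ← ha]; rfl
      rw [this] at hz
      exact sub_eq_zero.2 hz
    rw [map_sub, hPF, hP.apply_operatorDyad hker] at h0
    exact sub_eq_zero.1 h0
  have ha1 : ‖a‖ ≤ 1 := by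
    rw [← ha] at hξ
    exact ((inclusionInDoubleDualLi 𝕜 (E := X)).norm_map a).symm.le.trans hξ
  have hprod : 1 ≤ ‖a‖ * ‖γ‖ := by
    rw [← hF, hFa]
    exact norm_operatorDyad_le a γ
  refine ⟨a, γ, le_antisymm ha1 ?_, le_antisymm hγ ?_, hFa⟩ <;>
    nlinarith [norm_nonneg a, norm_nonneg γ]

open Filter Topology in
/-- If the compact operators form an `M`-ideal, the norming functional of a very smooth operator
is a dyad of unit vectors. -/
theorem IsVerySmoothPoint.exists_eq_operatorDyad [CompleteSpace X]
    (hM : IsMIdeal (compactOperator (RingHom.id 𝕜) X Y))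
    {T : X →L[𝕜] Y} (hT : IsVerySmoothPoint 𝕜 T) {F : StrongDual 𝕜 (X →L[𝕜] Y)}
    (hF : ‖F‖ = 1) (hFT : F T = 1) :
    ∃ (x : X) (g : StrongDual 𝕜 Y), ‖x‖ = 1 ∧ ‖g‖ = 1 ∧ F = operatorDyad x g := by
  obtain ⟨x, g, hx, hg, hlim⟩ := exists_seq_operatorDyad_tendsto T hT.1.1
  exact hM.exists_eq_operatorDyad (hyperfilter ℕ) hx hg hF
    (hT.2.tendsto_weakly hF.le hFT (hyperfilter ℕ) (fun n => operatorDyad (x n) (g n))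
      (fun n => (norm_operatorDyad_le _ _).trans (mul_le_one₀ (hx n) (norm_nonneg _) (hg n)))
      (hlim.mono_left Nat.hyperfilter_le_atTop))

/-- Equal dyads of unit vectors have unimodularly proportional first factors. -/
theorem exists_unimodular_smul_of_operatorDyad_eq {x x' : X} (hx : ‖x‖ = 1) (hx' : ‖x'‖ = 1)
    {g h : StrongDual 𝕜 Y} (hh : h ≠ 0) (hgh : operatorDyad x g = operatorDyad x' h) :
    ∃ c : 𝕜, ‖c‖ = 1 ∧ x' = c • x := by
  obtain ⟨y, hy⟩ : ∃ y, h y ≠ 0 := by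
    by_contra! hcon
    exact hh (ContinuousLinearMap.ext hcon)
  have hxx : x' = ((h y)⁻¹ * g y) • x := by
    refine (SeparatingDual.eq_iff_forall_dual_eq (R := 𝕜)).2 fun f => ?_
    have := congrArg (fun G => G (f.smulRight y)) hgh
    simp only [operatorDyad_apply, ContinuousLinearMap.smulRight_apply, map_smul,
      smul_eq_mul] at this ⊢
    field_simp
    linear_combination -this
  refine ⟨_, ?_, hxx⟩
  have := congrArg norm hxx
  rw [norm_smul, hx, hx', mul_one] at this
  exact this.symm

end Dyad

theorem corollary22 {𝕜 : Type*} [RCLike 𝕜]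
    {X : Type*} [NormedAddCommGroup X] [NormedSpace 𝕜 X] [CompleteSpace X]
    {Y : Type*} [NormedAddCommGroup Y] [NormedSpace 𝕜 Y] [CompleteSpace Y]
    (hM : IsMIdeal (compactOperator (RingHom.id 𝕜) X Y))
    (T : X →L[𝕜] Y) (hT : IsVerySmoothPoint 𝕜 T) :
    ∃ x : X, ‖x‖ = 1 ∧ ‖T x‖ = ‖T‖ ∧
      (∀ x' : X, ‖x'‖ = 1 → ‖T x'‖ = ‖T‖ → ∃ c : 𝕜, ‖c‖ = 1 ∧ x' = c • x) ∧
      IsVerySmoothPoint 𝕜 (T x) := by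
  obtain ⟨F, ⟨hF, hFT⟩, huniq⟩ := hT.1.2
  obtain ⟨x, g, hx, hg, rfl⟩ := hT.exists_eq_operatorDyad hM hF hFT
  have hTx : ‖T x‖ = 1 := by
    refine le_antisymm (by simpa [hT.1.1, hx] using T.le_opNorm x) ?_
    have hgTx : g (T x) = 1 := hFT
    simpa [hgTx, hg] using g.le_opNorm (T x)
  refine ⟨x, hx, hTx.trans hT.1.1.symm, fun x' hx' hTx' => ?_, ?_⟩
  · rw [hT.1.1] at hTx'
    obtain ⟨h, hh, hhx⟩ := exists_dual_vector 𝕜 (T x') (by simp [hTx'])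
    have hhx1 : h (T x') = 1 := by simp [hhx, hTx']
    refine exists_unimodular_smul_of_operatorDyad_eq hx hx' (norm_ne_zero_iff.1 (by simp [hh]))
      (huniq (operatorDyad x' h) ⟨?_, hhx1⟩).symm
    exact StrongDual.norm_eq_one_of_apply_eq_one (x := T)
      ((norm_operatorDyad_le x' h).trans (by simp [hx', hh])) hT.1.1.le hhx1
  · obtain ⟨f, hf, hfx⟩ := exists_dual_vector 𝕜 x (by simp [hx])
    refine hT.map_of_rightInverse (ContinuousLinearMap.apply 𝕜 Y x) ?_
      (ContinuousLinearMap.smulRightL 𝕜 X Y f) (fun y => ?_) hTx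
    · refine ContinuousLinearMap.opNorm_le_bound _ zero_le_one fun S => ?_
      simpa [hx] using S.le_opNorm x
    · simp [hfx, hx]
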